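/- Let $x=(x(t))_{t\in\mathbb R}$ be a real-valued, zero-mean, mean-square continuous, second-order stationary process on a probability space (all $x(t)\in L^2$, and $E[x(t)]$, $E[x(s)x(t)]$ are invariant under time shifts), and let $R(\tau)=E[x(\tau)x(0)]$. (1) There is exactly one non-decreasing right-continuous function $H$ on $\mathbb R$ (the integrated spectrum of $x$) with $H(-\infty)=0$, $H(\infty)=R(0)$ and $R(\tau)=\int_{-\infty}^{\infty}e^{i\omega\tau}\,dH(\omega)$ for all $\tau$. There is an orthogonal process $Z$ of $x$, i.e. a complex square-integrable process $Z(\omega)$, $\omega\in\mathbb R$, on the same probability space, with $E[Z(b)-Z(a)]=0$ and $E[|Z(b)-Z(a)|^2]=H(b)-H(a)$ for $a\le b$, with $E[(Z(b)-Z(a))^{*}(Z(d)-Z(c))]=0$ for $a\le b\le c\le d$, and with $x(t)=\int_{-\infty}^{\infty}e^{i\omega t}\,dZ(\omega)$ for all $t$. Here and below, $\int\varphi\,dZ$ for $\varphi\in L^2(dH)$ is the mean-square limit of $\sum_j c_j(Z(b_j)-Z(a_j))$ along step functions $\sum_j c_j 1_{(a_j,b_j]}\to\varphi$ in $L^2(dH)$.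 (2) Let $k:\mathbb R\to\mathbb R$ be continuous (for instance smooth) and such that $t\mapsto t_r=t+k(t)$ is a bijection of $\mathbb R$. Then there is a unique function $g$ such that the inverse time change is $t=t_r+g(t_r)$; it is $C^\infty$ if $k$ is $C^\infty$ and $1+k'$ vanishes nowhere. There is a unique process $y$ with $y(t_r)=x(t)$ whenever $t_r=t+k(t)$ (the resampled process); it is zero-mean with $y(t_r)\in L^2$ for all $t_r$. If $R$ is not constant, then $y$ is second-order stationary if and only if $g$ is affine, $g(t_r)=a\,t_r+b$; so $y$ is in general non-stationary. (3) Put $\phi_{t_r}(\omega)=\exp[i\omega(t_r+g(t_r))]$. Then $\phi_{t_r}\in L^2(dH)$ for all $t_r$, and for all $t_r',t_r$ the covariance $C(t_r',t_r)=E[y(t_r')y(t_r)]$ satisfies $$C(t_r',t_r)=\int_{-\infty}^{\infty}\phi_{t_r'}^{*}(\omega)\,\phi_{t_r}(\omega)\,dH(\omega).$$ For every orthogonal process $Z$ of $x$ as in (1), in particular with $E[|dZ|^2]=d\mu$ where $\mu=H$ is the integrated spectrum of $x$, and for all $t_r$, $$y(t_r)=\int_{-\infty}^{\infty}\exp[i\omega(t_r+g(t_r))]\,dZ(\omega).$$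 -/

import Mathlib

open MeasureTheory Filter Topology
open scoped ContDiff

noncomputable section

variable {Ω : Type*} [MeasurableSpace Ω]

/-- Second-order (weak) stationarity: the joint moments of orders one and two exist, are finite
and are invariant under a shift of time. -/
structure IsSecondOrderStationary (x : ℝ → Ω → ℝ) (P : Measure Ω) : Prop where
  memLp : ∀ t, MemLp (x t) 2 P
  mean_shift : ∀ t τ, ∫ o, x (t + τ) o ∂P = ∫ o, x t o ∂P
  moment_shift : ∀ s t τ, ∫ o, x (s + τ) o * x (t + τ) o ∂P = ∫ o, x s o * x t o ∂P

/-- Continuity in the mean-square sense (stochastic continuity). -/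
def IsMeanSquareContinuous (x : ℝ → Ω → ℝ) (P : Measure Ω) : Prop :=
  ∀ t, Tendsto (fun s => eLpNorm (x s - x t) 2 P) (𝓝 t) (𝓝 0)

/-- The covariance function `C(s, t) = E[y(s) y(t)]` of a zero-mean real process. -/
def covFun (y : ℝ → Ω → ℝ) (P : Measure Ω) (s t : ℝ) : ℝ := ∫ o, y s o * y t o ∂P

/-- The autocovariance function `R(τ) = E[x(τ) x(0)]` of a zero-mean stationary process. -/
def autocov (x : ℝ → Ω → ℝ) (P : Measure Ω) (τ : ℝ) : ℝ := covFun x P τ 0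

/-- `H` is the (non-normalized) integrated spectrum of the zero-mean stationary process `x`:
a non-decreasing right-continuous function with `H(-∞) = 0`, `H(∞) = R(0)` and
`R(τ) = ∫ exp(iωτ) dH(ω)` for all `τ`. -/
structure IsIntegratedSpectrum (x : ℝ → Ω → ℝ) (P : Measure Ω) (H : StieltjesFunction ℝ) :
    Prop where
  tendsto_atBot : Tendsto H atBot (𝓝 0)
  tendsto_atTop : Tendsto H atTop (𝓝 (autocov x P 0))
  autocov_eq : ∀ τ : ℝ,
    (autocov x P τ : ℂ) = ∫ w : ℝ, Complex.exp (Complex.I * w * τ) ∂H.measure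

/-- A complex process `Z` on the frequency axis that is orthogonal, with `E[dZ] = 0`,
`E[|dZ|²] = dH`, and uncorrelated increments over non-overlapping intervals. -/
structure IsOrthogonalProcess (Z : ℝ → Ω → ℂ) (H : StieltjesFunction ℝ) (P : Measure Ω) :
    Prop where
  memLp : ∀ w, MemLp (Z w) 2 P
  mean_incr : ∀ a b, a ≤ b → ∫ o, (Z b o - Z a o) ∂P = 0
  variance_incr : ∀ a b, a ≤ b → ∫ o, ‖Z b o - Z a o‖ ^ 2 ∂P = H b - H a
  orthogonal_incr : ∀ a b c d, a ≤ b → b ≤ c → c ≤ d →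
    ∫ o, starRingEnd ℂ (Z b o - Z a o) * (Z d o - Z c o) ∂P = 0

/-- A complex step function `∑ cₖ 1_{(aₖ, bₖ]}` on the real line, given by its data. -/
structure StepData where
  n : ℕ
  coeff : Fin n → ℂ
  left : Fin n → ℝ
  right : Fin n → ℝ
  left_le_right : ∀ i, left i ≤ right i

/-- The step function `∑ cₖ 1_{(aₖ, bₖ]}`. -/
def StepData.toFun (s : StepData) (w : ℝ) : ℂ :=
  ∑ i, (Set.Ioc (s.left i) (s.right i)).indicator (fun _ => s.coeff i) w

/-- The elementary integral `∑ cₖ (Z(bₖ) - Z(aₖ))` of a step function. -/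
def StepData.integral (s : StepData) (Z : ℝ → Ω → ℂ) (o : Ω) : ℂ :=
  ∑ i, s.coeff i * (Z (s.right i) o - Z (s.left i) o)

/-- `Y = ∫ φ dZ` in the mean-square sense, for `φ ∈ L²(dH)`: step functions converging to `φ` in
`L²(dH)` exist, and the elementary integrals of every such sequence converge to `Y` in `L²(P)`. -/
structure IsMeanSquareIntegral (Z : ℝ → Ω → ℂ) (H : StieltjesFunction ℝ) (P : Measure Ω)
    (φ : ℝ → ℂ) (Y : Ω → ℂ) : Prop where
  memLp_integrand : MemLp φ 2 H.measure
  memLp_integral : MemLp Y 2 P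
  exists_approx : ∃ s : ℕ → StepData,
    Tendsto (fun n => eLpNorm ((s n).toFun - φ) 2 H.measure) atTop (𝓝 0)
  tendsto_integral : ∀ s : ℕ → StepData,
    Tendsto (fun n => eLpNorm ((s n).toFun - φ) 2 H.measure) atTop (𝓝 0) →
    Tendsto (fun n => eLpNorm ((s n).integral Z - Y) 2 P) atTop (𝓝 0)

/-- `Z` is the orthogonal process of `x` (its Cramér representation): `Z` is orthogonal with
`E[|dZ|²] = dH` and `x(t) = ∫ exp(iωt) dZ(ω)` for all `t`. -/
structure IsCramerProcess (x : ℝ → Ω → ℝ) (Z : ℝ → Ω → ℂ) (H : StieltjesFunction ℝ)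
    (P : Measure Ω) : Prop where
  orthogonal : IsOrthogonalProcess Z H P
  repr : ∀ t : ℝ, IsMeanSquareIntegral Z H P
    (fun w => Complex.exp (Complex.I * w * t)) (fun o => (x t o : ℂ))

/-- `t = r + g(r)` is the inverse of the time change `r = t + k(t)`. -/
def IsInverseTimeChange (k g : ℝ → ℝ) : Prop :=
  ∀ t r : ℝ, r = t + k t ↔ t = r + g r

/-- `y` is the process `x` resampled under `r = t + k(t)`, i.e. `y(r) = x(t)`. -/
def IsResampled (x : ℝ → Ω → ℝ) (k : ℝ → ℝ) (y : ℝ → Ω → ℝ) : Prop :=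
  ∀ t r : ℝ, r = t + k t → y r = x t

/-- The functions `φ_r(ω) = exp[iω(r + g(r))]`. -/
def resampledBasis (g : ℝ → ℝ) (r : ℝ) (w : ℝ) : ℂ :=
  Complex.exp (Complex.I * w * ((r + g r : ℝ) : ℂ))

end

/-! Everything rests on one isometry. The exponentials `exp(iωt)` in `L²(dH)` have the same Gram
matrix as the variables `x(t)` in `L²(P)`, and they are total. So `exp(iωt) ↦ x(t)` extends to an
isometry `T` (`exists_linearIsometry_of_inner_eq`), and `Z(ω) = T 1_{(-∞, ω]}` is an orthogonal
process with `∫ φ dZ = T φ`. The spectrum `H` comes from Bochner's theorem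
(`exists_charFun_eq_of_inner_eq_sub`). After Gaussian damping the Fourier transform of `R` is a
positive multiple of a square norm. It is thus a nonnegative density, and Lévy continuity removes
the damping. Uniqueness of `H` is injectivity of characteristic functions. Resampling substitutes `t
= r + g(r)`, so the two representations of `y` are those of `x` at the new times. For the
stationarity criterion (`affine_of_shift_invariant`), conjugating a shift by the time change gives
an increasing bijection preserving `R(u - v)`. Unless `R` is constant this must be a translation:
otherwise an orbit converging to a fixed point would produce arbitrarily small periods of `R`. The
time change is then additive up to a constant and continuous, hence affine. -/

noncomputable section

/-! ### Rigidity of maps preserving `R(u - v)`. -/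

/-- A continuous bijection of the real line is a homeomorphism. -/
theorem exists_homeomorph_of_continuous_bijective {f : ℝ → ℝ} (hf : Continuous f)
    (hbij : Function.Bijective f) :
    ∃ h : ℝ ≃ₜ ℝ, ⇑h = f ∧ (StrictMono f ∨ StrictAnti f) := by
  rcases hf.strictMono_of_inj hbij.1 with hm | ha
  · exact ⟨(hm.orderIsoOfSurjective f hbij.2).toHomeomorph, rfl, Or.inl hm⟩
  · have hm : StrictMono (fun t => -f t) := fun s t h => neg_lt_neg (ha h)
    have hs : Function.Surjective (fun t => -f t) := fun r => by
      obtain ⟨t, ht⟩ := hbij.2 (-r)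
      exact ⟨t, by simp [ht]⟩
    refine ⟨(hm.orderIsoOfSurjective _ hs).toHomeomorph.trans (Homeomorph.neg ℝ), ?_, Or.inr ha⟩
    ext t
    simp

/-- A continuous function for which every level point of `R 0` is a period is constant as soon as
such points accumulate at `0`. -/
theorem eq_of_periods_accumulate {R : ℝ → ℝ} (hR : Continuous R)
    (hper : ∀ u, R u = R 0 → ∀ s, R (s + u) = R s)
    (hacc : ∀ ε > 0, ∃ u, R u = R 0 ∧ u ∈ Set.Ioo 0 ε) (τ : ℝ) : R τ = R 0 := by
  let S : AddSubgroup ℝ :=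
    { carrier := {u | ∀ s, R (s + u) = R s}
      zero_mem' := by simp
      add_mem' := fun {a b} ha hb s => by rw [← add_assoc, hb, ha]
      neg_mem' := fun {a} ha s => by rw [← ha (s + -a)]; simp }
  -- A subgroup of the line with arbitrarily small positive elements is dense.
  have hd : Dense (S : Set ℝ) := S.dense_of_not_isolated_zero fun ε hε => by
    obtain ⟨u, hu, hu'⟩ := hacc ε hε
    exact ⟨u, hper u hu, hu'⟩
  have hc : IsClosed {u | R u = R 0} := isClosed_eq hR continuous_const
  have hsub : (S : Set ℝ) ⊆ {u | R u = R 0} := fun u hu => by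
    simpa using hu 0
  exact hc.closure_subset_iff.2 hsub (hd τ)

/-- An increasing bijection of the line which preserves `R (u - v)` and fixes `p` does not move a
point `u > p` downwards. -/
theorem le_map_of_map_eq_self {R : ℝ → ℝ} (hR : Continuous R)
    (hper : ∀ u, R u = R 0 → ∀ s, R (s + u) = R s) (hne : ∃ τ, R τ ≠ R 0)
    (g : ℝ ≃o ℝ) (hg : ∀ u v, R (g u - g v) = R (u - v)) {p u : ℝ} (hp : g p = p) (hpu : p < u) :
    u ≤ g u := by
  by_contra! hlt
  obtain ⟨τ, hτ⟩ := hne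
  refine hτ (eq_of_periods_accumulate hR hper (fun ε hε => ?_) τ)
  -- The orbit of `u` decreases and stays above `p`, so it converges to a fixed point `q`. By
  -- invariance `R (v n - q)` does not depend on `n`, so it equals its limit `R 0`, and the
  -- differences `v n - q` are the small level points sought.
  let v : ℕ → ℝ := fun n => g^[n] u
  have hv : ∀ n, v (n + 1) = g (v n) := fun n => Function.iterate_succ_apply' _ _ _
  have hanti : StrictAnti v := strictAnti_nat_of_succ_lt fun n => by
    induction n with
    | zero => simpa [v] using hlt
    | succ n ih => rw [hv (n + 1)]; nth_rw 2 [hv n]; exact g.strictMono ih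
  have hbdd : ∀ n, p < v n := fun n => by
    induction n with
    | zero => exact hpu
    | succ n ih => rw [hv, ← hp]; exact g.strictMono ih
  have hlim := tendsto_atTop_ciInf hanti.antitone
    ⟨p, by rintro _ ⟨n, rfl⟩; exact (hbdd n).le⟩
  set q := ⨅ n, v n
  have hgc : Continuous g := g.continuous
  have hq : g q = q := by
    refine tendsto_nhds_unique ((hgc.tendsto q).comp hlim) ?_
    refine ((tendsto_add_atTop_iff_nat 1).2 hlim).congr fun n => hv n
  have hconst : ∀ n, R (v n - q) = R (u - q) := fun n => by
    induction n with
    | zero => rfl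
    | succ n ih => rw [hv, ← ih, ← hg (v n) q, hq]
  have hlim' : Tendsto (fun n => v n - q) atTop (𝓝 0) := by
    simpa using hlim.sub_const q
  have h0 : R (u - q) = R 0 := by
    refine tendsto_nhds_unique ?_ ((hR.tendsto 0).comp hlim')
    exact tendsto_const_nhds.congr fun n => (hconst n).symm
  obtain ⟨n, hn⟩ := ((hlim'.eventually_lt_const hε)).exists
  refine ⟨v n - q, (hconst n).trans h0, ?_, hn⟩
  have : q ≤ v (n + 1) := hanti.antitone.le_of_tendsto hlim (n + 1)
  have := hanti (Nat.lt_succ_self n)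
  simp only [Nat.succ_eq_add_one] at this
  linarith

/-- An increasing bijection of the line which preserves `R (u - v)` is a translation. -/
theorem map_sub_map_eq_sub {R : ℝ → ℝ} (hR : Continuous R)
    (hper : ∀ u, R u = R 0 → ∀ s, R (s + u) = R s) (hne : ∃ τ, R τ ≠ R 0)
    (g : ℝ ≃o ℝ) (hg : ∀ u v, R (g u - g v) = R (u - v)) (u v : ℝ) :
    g u - g v = u - v := by
  wlog huv : v < u generalizing u v
  · rcases (not_lt.1 huv).eq_or_lt with rfl | h
    · simp
    · linarith [this v u h]
  -- Correcting `g` by a translation makes `v` a fixed point. The lemma for `f` and for its inverse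
  -- gives the two inequalities.
  let f : ℝ ≃o ℝ := g.trans (OrderIso.addRight (v - g v))
  have hf : ∀ w, f w = g w + (v - g v) := fun w => rfl
  have hfi : ∀ a b, R (f a - f b) = R (a - b) := fun a b => by
    rw [hf, hf, add_sub_add_right_eq_sub, hg]
  have hfv : f v = v := by simp [hf]
  have h1 := le_map_of_map_eq_self hR hper hne f hfi hfv huv
  have h2 := le_map_of_map_eq_self hR hper hne f.symm
    (fun a b => by rw [← hfi, f.apply_symm_apply, f.apply_symm_apply])
    (by rw [f.symm_apply_eq, hfv]) huv
  rw [f.le_symm_apply] at h2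
  rw [hf] at h1 h2
  linarith

/-- A homeomorphic time change `θ` under which `R (θ r - θ s)` depends on `r - s` only is affine,
unless `R` is constant. -/
theorem affine_of_shift_invariant {R : ℝ → ℝ} (hR : Continuous R)
    (hper : ∀ u, R u = R 0 → ∀ s, R (s + u) = R s) (hne : ∃ τ, R τ ≠ R 0)
    (θ : ℝ ≃ₜ ℝ) (hθ : StrictMono θ.symm ∨ StrictAnti θ.symm)
    (hinv : ∀ r s τ, R (θ (r + τ) - θ (s + τ)) = R (θ r - θ s)) :
    ∃ a b : ℝ, ∀ r, θ r = a * r + b := by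
  have hadd : ∀ r τ, θ (r + τ) - θ τ = θ r - θ 0 := fun r τ => by
    -- The shift conjugated by `θ` is increasing even for decreasing `θ`, as the two reversals
    -- cancel.
    have hsm : StrictMono fun u => θ (θ.symm u + τ) := by
      rcases hθ with h | h
      · have h' : StrictMono θ := fun a b hab => by
          rw [← h.lt_iff_lt]; simpa using hab
        exact fun a b hab => h' (by simpa using h hab)
      · have h' : StrictAnti θ := fun a b hab => by
          rw [← h.lt_iff_gt]; simpa using hab
        exact fun a b hab => h' (by simpa using h hab)
    have hsurj : Function.Surjective fun u => θ (θ.symm u + τ) := fun w =>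
      ⟨θ (θ.symm w - τ), by simp⟩
    have := map_sub_map_eq_sub hR hper hne (hsm.orderIsoOfSurjective _ hsurj)
      (fun u v => by
        simp only [StrictMono.coe_orderIsoOfSurjective]
        rw [hinv]; simp) (θ r) (θ 0)
    simpa using this
  let L : ℝ →+ ℝ :=
    { toFun := fun r => θ r - θ 0
      map_zero' := sub_self _
      map_add' := fun r τ => by linarith [hadd r τ] }
  have hL : Continuous L := θ.continuous.sub continuous_const
  refine ⟨L 1, θ 0, fun r => ?_⟩
  have := map_real_smul L hL r 1
  have h2 : L r = r * L 1 := by simpa using this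
  have h3 : L r = θ r - θ 0 := rfl
  linarith

/-! ### Bochner's theorem for stationary curves. -/

section PositiveDefinite

open scoped FourierTransform

variable {E : Type*} [NormedAddCommGroup E] [InnerProductSpace ℂ E]

theorem continuous_of_inner_eq_sub {X : ℝ → E} (hX : Continuous X) {r : ℝ → ℂ}
    (hr : ∀ s t, inner ℂ (X s) (X t) = r (t - s)) : Continuous r := by
  have : r = fun t => inner ℂ (X 0) (X t) := by ext t; simp [hr]
  rw [this]
  exact continuous_const.inner hX

theorem norm_sq_of_inner_eq_sub {X : ℝ → E} {r : ℝ → ℂ}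
    (hr : ∀ s t, inner ℂ (X s) (X t) = r (t - s)) (t : ℝ) : (‖X t‖ ^ 2 : ℂ) = r 0 := by
  rw [← sub_self t, ← hr t t, inner_self_eq_norm_sq_to_K]; simp

theorem norm_eq_of_inner_eq_sub {X : ℝ → E} {r : ℝ → ℂ}
    (hr : ∀ s t, inner ℂ (X s) (X t) = r (t - s)) (t : ℝ) : ‖X t‖ = ‖X 0‖ := by
  have h := (norm_sq_of_inner_eq_sub hr t).trans (norm_sq_of_inner_eq_sub hr 0).symm
  have h' : ‖X t‖ ^ 2 = ‖X 0‖ ^ 2 := by exact_mod_cast h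
  exact (sq_eq_sq₀ (norm_nonneg _) (norm_nonneg _)).1 h'

theorem norm_le_of_inner_eq_sub {X : ℝ → E} {r : ℝ → ℂ}
    (hr : ∀ s t, inner ℂ (X s) (X t) = r (t - s)) (t : ℝ) : ‖r t‖ ≤ ‖X 0‖ ^ 2 := by
  have h := norm_inner_le_norm (𝕜 := ℂ) (X 0) (X t)
  rwa [hr, sub_zero, norm_eq_of_inner_eq_sub hr t, ← sq] at h

theorem integrable_gaussian_mul {r : ℝ → ℂ} (hc : Continuous r) {C : ℝ} (hC : ∀ t, ‖r t‖ ≤ C)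
    {a : ℝ} (ha : 0 < a) : Integrable fun u : ℝ => (Real.exp (-a * u ^ 2) : ℂ) * r u := by
  refine (integrable_exp_neg_mul_sq ha).ofReal.mul_bdd (c := C) hc.aestronglyMeasurable
    (Eventually.of_forall hC)

/-- The square norm of a damped Fourier integral of a stationary curve. -/
theorem norm_sq_integral_gaussian_smul [CompleteSpace E] {X : ℝ → E} (hX : Continuous X)
    {r : ℝ → ℂ} (hr : ∀ s t, inner ℂ (X s) (X t) = r (t - s)) {a : ℝ} (ha : 0 < a) (w : ℝ) :
    ((‖∫ t : ℝ, ((Real.exp (-(2 * a) * t ^ 2) : ℂ) * Complex.exp (-(2 * Real.pi * t * w : ℝ) *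
      Complex.I)) • X t‖ ^ 2 : ℝ) : ℂ) =
      ((∫ t : ℝ, Real.exp (-(4 * a) * t ^ 2) : ℝ) : ℂ) *
        𝓕 (fun u : ℝ => (Real.exp (-a * u ^ 2) : ℂ) * r u) w := by
  have hrc := continuous_of_inner_eq_sub hX hr
  set h : ℝ → ℂ := fun t => (Real.exp (-(2 * a) * t ^ 2) : ℂ) *
    Complex.exp (-(2 * Real.pi * t * w : ℝ) * Complex.I) with hh
  have hhc : Continuous h := by fun_prop
  have hhn : ∀ t, ‖h t‖ = Real.exp (-(2 * a) * t ^ 2) := fun t => by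
    rw [hh]
    simp only [norm_mul, Complex.norm_real, Real.norm_eq_abs, Real.abs_exp]
    rw [← Complex.ofReal_neg, Complex.norm_exp_ofReal_mul_I, mul_one]
  have hint : Integrable fun t => h t • X t := by
    refine Integrable.mono' ((integrable_exp_neg_mul_sq (b := 2 * a) (by positivity)).mul_const
      ‖X 0‖) (hhc.smul hX).aestronglyMeasurable (Eventually.of_forall fun t => ?_)
    rw [norm_smul, hhn, norm_eq_of_inner_eq_sub hr]
  set V := ∫ t, h t • X t with hV
  have h1 : ∀ t, inner ℂ (X t) V = ∫ u, h (t + u) * r u := fun t => by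
    rw [hV, ← integral_inner hint, ← integral_add_left_eq_self _ t]
    refine integral_congr_ae (Eventually.of_forall fun u => ?_)
    simp only [inner_smul_right, hr]
    simp
  have h2 : ((‖V‖ ^ 2 : ℝ) : ℂ) = ∫ t, ∫ u, starRingEnd ℂ (h t) * h (t + u) * r u := by
    have e1 : inner ℂ V V = ∫ t, inner ℂ V (h t • X t) := by
      rw [integral_inner hint]
    have e2 : starRingEnd ℂ (inner ℂ V V) = inner ℂ V V := inner_conj_symm _ _
    have e3 : inner ℂ V V = ((‖V‖ ^ 2 : ℝ) : ℂ) := by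
      rw [inner_self_eq_norm_sq_to_K]; simp
    rw [← e3, ← e2, e1, ← integral_conj]
    refine integral_congr_ae (Eventually.of_forall fun t => ?_)
    simp only [inner_conj_symm, inner_smul_left, h1, mul_assoc]
    rw [integral_const_mul]
  -- Completing the square: `2t² + 2(t + u)² = 4(t + u/2)² + u²`. The `t`-integral then becomes a
  -- constant by translation invariance.
  have hprod : ∀ t u, starRingEnd ℂ (h t) * h (t + u) =
      (Real.exp (-(4 * a) * (t + u / 2) ^ 2) : ℂ) * ((Real.exp (-a * u ^ 2) : ℂ) *
        Complex.exp (-(2 * Real.pi * u * w : ℝ) * Complex.I)) := fun t u => by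
    simp only [hh, map_mul, Complex.conj_ofReal, ← Complex.exp_conj, map_neg, Complex.conj_I]
    simp only [Complex.ofReal_exp, ← Complex.exp_add]
    congr 1
    push_cast
    ring
  have hF : Integrable (Function.uncurry fun t u => starRingEnd ℂ (h t) * h (t + u) * r u)
      (volume.prod volume) := by
    -- The rate `2a/3` works because `2t² + 2(t + u)² - (2/3)(t² + u²)` equals `((3t + 2u)² +
    -- t²)/3`, which is nonnegative.
    have hg := integrable_exp_neg_mul_sq (b := 2 * a / 3) (by positivity)
    refine Integrable.mono' ((hg.mul_prod hg).mul_const (‖X 0‖ ^ 2)) ?_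
      (Eventually.of_forall fun z => ?_)
    · refine Continuous.aestronglyMeasurable ?_
      simp only [Function.uncurry_def]
      fun_prop
    · obtain ⟨t, u⟩ := z
      simp only [Function.uncurry_apply_pair, norm_mul, RCLike.norm_conj, hhn]
      refine mul_le_mul ?_ (norm_le_of_inner_eq_sub hr u) (norm_nonneg _) (by positivity)
      rw [← Real.exp_add, ← Real.exp_add, Real.exp_le_exp]
      nlinarith [mul_nonneg ha.le (sq_nonneg (3 * t + 2 * u)), mul_nonneg ha.le (sq_nonneg t)]
  rw [h2, integral_integral_swap hF, Real.fourier_real_eq_integral_exp_smul, ← integral_const_mul]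
  refine integral_congr_ae (Eventually.of_forall fun u => ?_)
  simp only [hprod, mul_assoc]
  rw [integral_mul_const, integral_complex_ofReal,
    integral_add_right_eq_self (fun t => Real.exp (-(4 * a) * t ^ 2)) (u / 2)]
  simp only [smul_eq_mul]
  push_cast
  ring_nf

/-- The transform is a square norm divided by a positive Gaussian integral. -/
theorem fourier_gaussian_mul_nonneg [CompleteSpace E] {X : ℝ → E} (hX : Continuous X)
    {r : ℝ → ℂ} (hr : ∀ s t, inner ℂ (X s) (X t) = r (t - s)) {a : ℝ} (ha : 0 < a) (w : ℝ) :
    0 ≤ (𝓕 (fun u : ℝ => (Real.exp (-a * u ^ 2) : ℂ) * r u) w).re ∧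
      (((𝓕 (fun u : ℝ => (Real.exp (-a * u ^ 2) : ℂ) * r u) w).re : ℝ) : ℂ) =
        𝓕 (fun u : ℝ => (Real.exp (-a * u ^ 2) : ℂ) * r u) w := by
  have h := norm_sq_integral_gaussian_smul hX hr ha w
  have hc : 0 < ∫ t : ℝ, Real.exp (-(4 * a) * t ^ 2) := by
    rw [integral_gaussian]; positivity
  set c := ∫ t : ℝ, Real.exp (-(4 * a) * t ^ 2)
  set F := 𝓕 (fun u : ℝ => (Real.exp (-a * u ^ 2) : ℂ) * r u) w
  have h1 := congrArg Complex.re h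
  have h2 := congrArg Complex.im h
  rw [Complex.re_ofReal_mul, Complex.ofReal_re] at h1
  rw [Complex.im_ofReal_mul, Complex.ofReal_im] at h2
  have h3 : F.im = 0 := by
    rcases mul_eq_zero.1 h2.symm with h | h
    · exact absurd h hc.ne'
    · exact h
  refine ⟨?_, Complex.ext (by simp) (by simp [h3])⟩
  by_contra! hneg
  nlinarith [sq_nonneg ‖∫ t : ℝ, ((Real.exp (-(2 * a) * t ^ 2) : ℂ) *
    Complex.exp (-(2 * Real.pi * t * w : ℝ) * Complex.I)) • X t‖]

/-- A nonnegative Fourier transform of a continuous integrable function is integrable. -/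
theorem integrable_fourier_of_nonneg {f : ℝ → ℂ} (hf : Integrable f) (hc : Continuous f)
    (hpos : ∀ w, 0 ≤ (𝓕 f w).re ∧ (((𝓕 f w).re : ℝ) : ℂ) = 𝓕 f w) : Integrable (𝓕 f) := by
  -- Gaussian-regularized Fourier inversion at the origin. It needs no integrability of `𝓕 f`, and
  -- Fatou's lemma turns it into the bound `∫ 𝓕 f ≤ f 0`.
  have A : Tendsto (fun c : ℝ => ∫ w : ℝ, Complex.exp (-(c : ℂ)⁻¹ * ‖w‖ ^ 2) * 𝓕 f w)
      atTop (𝓝 (f 0)) := by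
    have hB := Real.tendsto_integral_gaussian_smul' hf (v := 0) hc.continuousAt
    refine hB.congr' ?_
    filter_upwards [Ioi_mem_atTop 0] with c (hc : 0 < c)
    have J : Integrable (fun w : ℝ ↦ Complex.exp (-(c : ℂ)⁻¹ * ‖w‖ ^ 2 +
        2 * Real.pi * Complex.I * (inner ℝ (0 : ℝ) w : ℝ))) :=
      GaussianFourier.integrable_cexp_neg_mul_sq_norm_add (by simpa) _ _
    have hflip : ∫ w, 𝓕 (fun w : ℝ ↦ Complex.exp (-(c : ℂ)⁻¹ * ‖w‖ ^ 2 +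
        2 * Real.pi * Complex.I * (inner ℝ (0 : ℝ) w : ℝ))) w • f w =
        ∫ w, Complex.exp (-(c : ℂ)⁻¹ * ‖w‖ ^ 2 +
        2 * Real.pi * Complex.I * (inner ℝ (0 : ℝ) w : ℝ)) • 𝓕 f w := by
      simpa using! VectorFourier.integral_fourierIntegral_smul_eq_flip (L := innerₗ ℝ)
        Real.continuous_fourierChar continuous_inner J hf
    convert! hflip using 3 with w
    · rw [fourier_gaussian_innerProductSpace' (by simpa)]
      congr 2
      · simp
      · congr 1
        simp
        ring
    · simp
  have hFc : Continuous (𝓕 f) := by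
    have := VectorFourier.fourierIntegral_continuous Real.continuous_fourierChar
      (L := innerₗ ℝ) continuous_inner hf
    simpa using! this
  set p : ℝ → ℝ := fun w => (𝓕 f w).re
  have hpF : 𝓕 f = fun w => (p w : ℂ) := by ext w; exact (hpos w).2.symm
  have hpc : Continuous p := Complex.continuous_re.comp hFc
  have hA : ∀ c : ℝ, ∫ w : ℝ, Complex.exp (-(c : ℂ)⁻¹ * ‖w‖ ^ 2) * 𝓕 f w =
      ((∫ w : ℝ, Real.exp (-c⁻¹ * w ^ 2) * p w : ℝ) : ℂ) := fun c => by
    rw [← integral_complex_ofReal]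
    refine integral_congr_ae (Eventually.of_forall fun w => ?_)
    simp only [hpF]
    rw [← Complex.ofReal_pow, Real.norm_eq_abs, sq_abs]
    push_cast
    ring
  simp only [hA] at A
  have A' : Tendsto (fun n : ℕ => ∫ w : ℝ, Real.exp (-(n : ℝ)⁻¹ * w ^ 2) * p w) atTop
      (𝓝 (f 0).re) := by
    have := (Complex.continuous_re.tendsto _).comp (A.comp tendsto_natCast_atTop_atTop)
    exact this
  have hpb : ∃ C, ∀ w, ‖p w‖ ≤ C := by
    refine ⟨∫ v, ‖f v‖, fun w => (Complex.abs_re_le_norm _).trans ?_⟩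
    exact VectorFourier.norm_fourierIntegral_le_integral_norm _ _ _ f w
  obtain ⟨C, hC⟩ := hpb
  -- At `n = 0` the inverse is `0` and there is no damping, so that index is excluded.
  have hint : ∀ n : ℕ, 0 < n → Integrable fun w : ℝ => Real.exp (-(n : ℝ)⁻¹ * w ^ 2) * p w :=
    fun n hn => (integrable_exp_neg_mul_sq (by positivity)).mul_bdd (c := C)
      hpc.aestronglyMeasurable (Eventually.of_forall hC)
  have hle : ∫⁻ w, ENNReal.ofReal (p w) ≤ ENNReal.ofReal (f 0).re := by
    have hlim : ∀ w, Tendsto (fun n : ℕ => ENNReal.ofReal (Real.exp (-(n : ℝ)⁻¹ * w ^ 2) * p w))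
        atTop (𝓝 (ENNReal.ofReal (p w))) := fun w => by
      refine ENNReal.tendsto_ofReal ?_
      have : Tendsto (fun n : ℕ => Real.exp (-(n : ℝ)⁻¹ * w ^ 2) * p w) atTop
          (𝓝 (Real.exp (-0 * w ^ 2) * p w)) :=
        ((Real.continuous_exp.tendsto _).comp
          (tendsto_inv_atTop_nhds_zero_nat.neg.mul_const _)).mul_const _
      simpa using this
    calc ∫⁻ w, ENNReal.ofReal (p w)
        = ∫⁻ w, liminf (fun n : ℕ => ENNReal.ofReal (Real.exp (-(n : ℝ)⁻¹ * w ^ 2) * p w))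
            atTop := by simp only [(hlim _).liminf_eq]
      _ ≤ liminf (fun n : ℕ => ∫⁻ w, ENNReal.ofReal (Real.exp (-(n : ℝ)⁻¹ * w ^ 2) * p w))
            atTop := lintegral_liminf_le fun n => by fun_prop
      _ = ENNReal.ofReal (f 0).re := by
          refine Tendsto.liminf_eq ((ENNReal.tendsto_ofReal A').congr' ?_)
          filter_upwards [eventually_gt_atTop 0] with n hn
          refine ofReal_integral_eq_lintegral_ofReal (hint n hn) (Eventually.of_forall fun w => ?_)
          exact mul_nonneg (Real.exp_nonneg _) (hpos w).1
  have hpi : Integrable p := by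
    refine ⟨hpc.aestronglyMeasurable, ?_⟩
    rw [hasFiniteIntegral_iff_ofReal (Eventually.of_forall fun w => (hpos w).1)]
    exact hle.trans_lt ENNReal.ofReal_lt_top
  rw [hpF]
  exact hpi.ofReal

/-- A continuous integrable function with nonnegative Fourier transform and value `1` at the origin
is a characteristic function. -/
theorem exists_charFun_eq_of_fourier_nonneg {f : ℝ → ℂ} (hf : Integrable f) (hc : Continuous f)
    (hpos : ∀ w, 0 ≤ (𝓕 f w).re ∧ (((𝓕 f w).re : ℝ) : ℂ) = 𝓕 f w) (h1 : f 0 = 1) :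
    ∃ μ : Measure ℝ, IsProbabilityMeasure μ ∧ ∀ t, charFun μ t = f t := by
  have hi := integrable_fourier_of_nonneg hf hc hpos
  set p : ℝ → ℝ := fun w => (𝓕 f w).re
  have hpF : 𝓕 f = fun w => (p w : ℂ) := by ext w; exact (hpos w).2.symm
  have hpi : Integrable p := hi.re
  let ν : Measure ℝ := volume.withDensity fun w => ENNReal.ofReal (p w)
  have hν : IsFiniteMeasure ν := isFiniteMeasure_withDensity_ofReal hpi.2
  -- The dilation by `2π` reconciles the kernel `exp(2πitw)` of `𝓕` with the kernel `exp(itw)` of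
  -- `charFun`.
  have hμf : IsFiniteMeasure (ν.map (2 * Real.pi * ·)) := inferInstance
  have hchar : ∀ t, charFun (ν.map (2 * Real.pi * ·)) t = f t := fun t => by
    rw [charFun_map_mul, charFun_apply_real, ← congrFun (hc.fourierInv_fourier_eq hf hi) t,
      Real.fourierInv_eq']
    rw [integral_withDensity_eq_integral_toReal_smul₀ hpi.aemeasurable.ennreal_ofReal
      (Eventually.of_forall fun w => ENNReal.ofReal_lt_top)]
    refine integral_congr_ae (Eventually.of_forall fun w => ?_)
    have hw : (ENNReal.ofReal (p w)).toReal = p w := ENNReal.toReal_ofReal (hpos w).1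
    have hw' : 𝓕 f w = p w := (hpos w).2.symm
    simp only [hw, hw', Complex.real_smul, smul_eq_mul]
    rw [mul_comm]
    congr 2
    simp
    ring
  refine ⟨_, ⟨?_⟩, hchar⟩
  have h := hchar 0
  rw [charFun_zero, h1] at h
  have h' : (ν.map (2 * Real.pi * ·)).real Set.univ = 1 := by exact_mod_cast h
  rwa [measureReal_def, ENNReal.toReal_eq_one_iff] at h'

/-- A pointwise limit of characteristic functions which is continuous at the origin is a
characteristic function. -/
theorem exists_charFun_eq_of_tendsto {μ : ℕ → Measure ℝ} [∀ n, IsProbabilityMeasure (μ n)]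
    {r : ℝ → ℂ} (hr : ContinuousAt r 0)
    (h : ∀ t, Tendsto (fun n => charFun (μ n) t) atTop (𝓝 (r t))) :
    ∃ ν : Measure ℝ, IsProbabilityMeasure ν ∧ ∀ t, charFun ν t = r t := by
  have ht := isTightMeasureSet_of_tendsto_charFun hr h
  let m : ℕ → ProbabilityMeasure ℝ := fun n => ⟨μ n, inferInstance⟩
  have hcomp : IsCompact (closure (Set.range m)) := by
    refine isCompact_closure_of_isTightMeasureSet ?_
    convert ht using 1
    ext ρ
    constructor
    · rintro ⟨_, ⟨n, rfl⟩, rfl⟩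
      exact ⟨n, rfl⟩
    · rintro ⟨n, rfl⟩
      exact ⟨m n, ⟨n, rfl⟩, rfl⟩
  -- Tightness gives compactness, and an ultrafilter finer than `atTop` replaces the choice of a
  -- convergent subsequence.
  let U : Ultrafilter ℕ := Ultrafilter.of atTop
  obtain ⟨ν, -, hν⟩ := hcomp.ultrafilter_le_nhds (U.map m)
    (.trans (by simp) (monotone_principal subset_closure))
  have hν' : Tendsto m U (𝓝 ν) := hν
  refine ⟨ν, inferInstance, fun t => ?_⟩
  rw [ProbabilityMeasure.tendsto_iff_forall_integral_rclike_tendsto ℂ] at hν'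
  have h2 := hν' (BoundedContinuousFunction.innerProbChar t)
  simp_rw [← charFun_eq_integral_innerProbChar] at h2
  exact tendsto_nhds_unique h2 ((h t).mono_left (Ultrafilter.of_le _))

/-- **Bochner's theorem** for the correlation function of a stationary curve in a Hilbert space. -/
theorem exists_charFun_eq_of_inner_eq_sub [CompleteSpace E] {X : ℝ → E} (hX : Continuous X)
    {r : ℝ → ℂ} (hr : ∀ s t, inner ℂ (X s) (X t) = r (t - s)) (h1 : r 0 = 1) :
    ∃ μ : Measure ℝ, IsProbabilityMeasure μ ∧ ∀ t, charFun μ t = r t := by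
  have hrc := continuous_of_inner_eq_sub hX hr
  have hex : ∀ n : ℕ, ∃ μ : Measure ℝ, IsProbabilityMeasure μ ∧ ∀ t, charFun μ t =
      (Real.exp (-((n : ℝ) + 1)⁻¹ * t ^ 2) : ℂ) * r t := fun n =>
    exists_charFun_eq_of_fourier_nonneg
      (integrable_gaussian_mul hrc (norm_le_of_inner_eq_sub hr) (by positivity)) (by fun_prop)
      (fourier_gaussian_mul_nonneg hX hr (by positivity)) (by simp [h1])
  choose μ hμ hμr using hex
  refine exists_charFun_eq_of_tendsto (μ := μ) hrc.continuousAt fun t => ?_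
  simp only [hμr]
  have h0 : Tendsto (fun n : ℕ => ((n : ℝ) + 1)⁻¹) atTop (𝓝 0) := by
    simpa using tendsto_one_div_add_atTop_nhds_zero_nat (𝕜 := ℝ)
  have h2 : Tendsto (fun n : ℕ => (Real.exp (-((n : ℝ) + 1)⁻¹ * t ^ 2) : ℂ) * r t) atTop
      (𝓝 ((Real.exp (-0 * t ^ 2) : ℂ) * r t)) :=
    ((Complex.continuous_ofReal.tendsto _).comp ((Real.continuous_exp.tendsto _).comp
      (h0.neg.mul_const _))).mul_const _
  simpa using h2

end PositiveDefinite

/-! ### Total families in `L²(μ)`: exponentials and interval indicators. -/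

section Density

variable {μ : Measure ℝ}

/-- `ENNReal.ofReal` truncates at zero, so the two densities are the positive and negative parts of
`g`. They never are both nonzero, so equality forces both to vanish. -/
theorem ae_eq_zero_of_withDensity_eq {α : Type*} [MeasurableSpace α] {μ : Measure α} {g : α → ℝ}
    (hg : Integrable g μ)
    (h : μ.withDensity (fun w => ENNReal.ofReal (g w)) =
      μ.withDensity (fun w => ENNReal.ofReal (-g w))) : g =ᵐ[μ] 0 := by
  have h2 := (withDensity_eq_iff hg.aemeasurable.ennreal_ofReal
    hg.aemeasurable.neg.ennreal_ofReal hg.lintegral_lt_top.ne).1 h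
  filter_upwards [h2] with w hw
  rcases le_total (g w) 0 with h0 | h0
  · rw [ENNReal.ofReal_of_nonpos h0, eq_comm, ENNReal.ofReal_eq_zero] at hw
    exact le_antisymm h0 (by simpa using hw)
  · rw [Pi.neg_apply, ENNReal.ofReal_of_nonpos (p := -g w) (by linarith), ENNReal.ofReal_eq_zero] at hw
    exact le_antisymm hw h0

/-- A real integrable density is determined by its Fourier transform. -/
theorem ae_eq_zero_of_forall_integral_exp_mul_ofReal {g : ℝ → ℝ} (hg : Integrable g μ)
    (h : ∀ t : ℝ, ∫ w : ℝ, Complex.exp (Complex.I * w * t) * g w ∂μ = 0) : g =ᵐ[μ] 0 := by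
  refine ae_eq_zero_of_withDensity_eq hg ?_
  have : IsFiniteMeasure (μ.withDensity fun w => ENNReal.ofReal (g w)) :=
    isFiniteMeasure_withDensity_ofReal hg.2
  have : IsFiniteMeasure (μ.withDensity fun w => ENNReal.ofReal (-g w)) :=
    isFiniteMeasure_withDensity_ofReal hg.neg.2
  refine Measure.ext_of_charFun (funext fun t => ?_)
  have hchar : ∀ f : ℝ → ℝ, Integrable f μ →
      charFun (μ.withDensity fun w => ENNReal.ofReal (f w)) t =
        ∫ w : ℝ, Complex.exp (Complex.I * w * t) * (max (f w) 0 : ℝ) ∂μ := fun f hf => by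
    rw [charFun_apply_real, integral_withDensity_eq_integral_toReal_smul₀
      hf.aemeasurable.ennreal_ofReal (Eventually.of_forall fun w => ENNReal.ofReal_lt_top)]
    refine integral_congr_ae (Eventually.of_forall fun w => ?_)
    simp only [ENNReal.toReal_ofReal', Complex.real_smul]
    rw [mul_comm]
    congr 2
    ring
  have hint : ∀ f : ℝ → ℝ, Integrable f μ →
      Integrable (fun w : ℝ => Complex.exp (Complex.I * w * t) * (max (f w) 0 : ℝ)) μ :=
    fun f hf => by
      refine hf.pos_part.ofReal.bdd_mul (c := 1) (by fun_prop) (Eventually.of_forall fun w => ?_)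
      rw [mul_assoc, ← Complex.ofReal_mul, mul_comm, Complex.norm_exp_ofReal_mul_I]
  rw [hchar g hg, hchar (fun w => -g w) hg.neg, ← sub_eq_zero,
    ← integral_sub (hint g hg) (hint (fun w => -g w) hg.neg), ← h t]
  refine integral_congr_ae (Eventually.of_forall fun w => ?_)
  simp only [← mul_sub, ← Complex.ofReal_sub]
  congr 2
  rcases le_total (g w) 0 with h0 | h0
  · rw [max_eq_right h0, max_eq_left (by linarith)]; ring
  · rw [max_eq_left h0, max_eq_right (by linarith)]; ring

/-- Conjugating the hypothesis at `-t` shows that the conjugate of `f` has zero transform too, hence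
so does the real part. The imaginary part of `f` is the real part of `-i f`. -/
theorem ae_eq_zero_of_forall_integral_exp_mul {f : ℝ → ℂ} (hf : Integrable f μ)
    (h : ∀ t : ℝ, ∫ w : ℝ, Complex.exp (Complex.I * w * t) * f w ∂μ = 0) : f =ᵐ[μ] 0 := by
  have hre : ∀ f : ℝ → ℂ, Integrable f μ →
      (∀ t : ℝ, ∫ w : ℝ, Complex.exp (Complex.I * w * t) * f w ∂μ = 0) →
      (fun w => (f w).re) =ᵐ[μ] 0 := fun f hf h => by
    refine ae_eq_zero_of_forall_integral_exp_mul_ofReal hf.re fun t => ?_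
    have hint : Integrable (fun w : ℝ => Complex.exp (Complex.I * w * t) * f w) μ := by
      refine hf.bdd_mul (c := 1) (by fun_prop) (Eventually.of_forall fun w => ?_)
      rw [mul_assoc, ← Complex.ofReal_mul, mul_comm, Complex.norm_exp_ofReal_mul_I]
    have hconj : ∀ w : ℝ, Complex.exp (Complex.I * w * t) * starRingEnd ℂ (f w) =
        starRingEnd ℂ (Complex.exp (Complex.I * w * (-t : ℝ)) * f w) := fun w => by
      rw [map_mul, ← Complex.exp_conj]
      simp
    have hint' : Integrable (fun w : ℝ => Complex.exp (Complex.I * w * t) *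
        starRingEnd ℂ (f w)) μ := by
      refine hf.norm.mono' ?_ ?_
      · exact (Continuous.aestronglyMeasurable (by fun_prop)).mul
          (Complex.continuous_conj.comp_aestronglyMeasurable hf.1)
      · refine Eventually.of_forall fun w => ?_
        rw [norm_mul, mul_assoc, ← Complex.ofReal_mul, mul_comm Complex.I,
          Complex.norm_exp_ofReal_mul_I, one_mul, RCLike.norm_conj]
    have h0 : ∫ w : ℝ, Complex.exp (Complex.I * w * t) * starRingEnd ℂ (f w) ∂μ = 0 := by
      simp only [hconj]
      rw [integral_conj, h, map_zero]
    have hsum : ∀ w : ℝ, Complex.exp (Complex.I * w * t) * ((f w).re : ℂ) = 2⁻¹ *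
        (Complex.exp (Complex.I * w * t) * f w +
          Complex.exp (Complex.I * w * t) * starRingEnd ℂ (f w)) := fun w => by
      rw [Complex.re_eq_add_conj]; ring
    simp only [hsum]
    change ∫ w : ℝ, 2⁻¹ * (Complex.exp (Complex.I * w * t) * f w +
          Complex.exp (Complex.I * w * t) * starRingEnd ℂ (f w)) ∂μ = 0
    rw [integral_const_mul, integral_add hint hint', h, h0]
    simp
  have h1 := hre f hf h
  have h2 := hre (fun w => -Complex.I * f w) (hf.const_mul _) fun t => by
    have : ∀ w : ℝ, Complex.exp (Complex.I * w * t) * (-Complex.I * f w) =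
        -Complex.I * (Complex.exp (Complex.I * w * t) * f w) := fun w => by ring
    simp only [this]
    rw [integral_const_mul, h, mul_zero]
  filter_upwards [h1, h2] with w hw1 hw2
  exact Complex.ext (by simpa using hw1) (by simpa using hw2)

theorem ae_eq_zero_of_forall_setIntegral_Ioc {f : ℝ → ℂ} (hf : Integrable f μ)
    (h : ∀ a b : ℝ, a ≤ b → ∫ w in Set.Ioc a b, f w ∂μ = 0) : f =ᵐ[μ] 0 := by
  have hreal : ∀ g : ℝ → ℝ, Integrable g μ →
      (∀ a b : ℝ, a ≤ b → ∫ w in Set.Ioc a b, g w ∂μ = 0) → g =ᵐ[μ] 0 := fun g hg h => by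
    refine ae_eq_zero_of_withDensity_eq hg ?_
    have : IsFiniteMeasure (μ.withDensity fun w => ENNReal.ofReal (g w)) :=
      isFiniteMeasure_withDensity_ofReal hg.2
    have : IsFiniteMeasure (μ.withDensity fun w => ENNReal.ofReal (-g w)) :=
      isFiniteMeasure_withDensity_ofReal hg.neg.2
    refine Measure.ext_of_Ioc _ _ fun a b hab => ?_
    have h0 := h a b hab.le
    rw [integral_eq_lintegral_pos_part_sub_lintegral_neg_part hg.integrableOn,
      ← withDensity_apply _ measurableSet_Ioc, ← withDensity_apply _ measurableSet_Ioc,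
      sub_eq_zero] at h0
    exact (ENNReal.toReal_eq_toReal_iff' (measure_ne_top _ _) (measure_ne_top _ _)).1 h0
  have h1 := hreal (fun w => (f w).re) hf.re fun a b hab => by
    have := integral_re (hf.integrableOn (s := Set.Ioc a b))
    rw [h a b hab] at this
    simpa using this
  have h2 := hreal (fun w => (f w).im) hf.im fun a b hab => by
    have := integral_im (hf.integrableOn (s := Set.Ioc a b))
    rw [h a b hab] at this
    simpa using this
  filter_upwards [h1, h2] with w hw1 hw2
  exact Complex.ext (by simpa using hw1) (by simpa using hw2)

variable [IsFiniteMeasure μ]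

theorem memLp_exp_I_mul (μ : Measure ℝ) [IsFiniteMeasure μ] (t : ℝ) :
    MemLp (fun w : ℝ => Complex.exp (Complex.I * w * t)) 2 μ := by
  refine MemLp.of_bound (by fun_prop) 1 (Eventually.of_forall fun w => ?_)
  rw [mul_assoc, ← Complex.ofReal_mul, mul_comm, Complex.norm_exp_ofReal_mul_I]

/-- The exponential `ω ↦ exp(iωt)` as an element of `L²(μ)`. -/
def expLp (μ : Measure ℝ) [IsFiniteMeasure μ] (t : ℝ) : Lp ℂ 2 μ := (memLp_exp_I_mul μ t).toLp

theorem inner_expLp (s : ℝ) (f : Lp ℂ 2 μ) :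
    inner ℂ (expLp μ s) f = ∫ w : ℝ, Complex.exp (Complex.I * w * (-s : ℝ)) * f w ∂μ := by
  rw [L2.inner_def]
  refine integral_congr_ae ?_
  filter_upwards [(memLp_exp_I_mul μ s).coeFn_toLp] with w hw
  rw [expLp, hw, RCLike.inner_apply, ← Complex.exp_conj, mul_comm]
  simp

theorem inner_expLp_expLp (s t : ℝ) :
    inner ℂ (expLp μ s) (expLp μ t) = ∫ w : ℝ, Complex.exp (Complex.I * w * (t - s : ℝ)) ∂μ := by
  rw [inner_expLp]
  refine integral_congr_ae ?_
  filter_upwards [(memLp_exp_I_mul μ t).coeFn_toLp] with w hw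
  rw [expLp, hw, ← Complex.exp_add]
  congr 1
  push_cast
  ring

/-- An element orthogonal to all exponentials has zero Fourier transform against `μ`. -/
theorem span_expLp_topologicalClosure :
    (Submodule.span ℂ (Set.range (expLp μ))).topologicalClosure = ⊤ := by
  rw [Submodule.topologicalClosure_eq_top_iff, Submodule.eq_bot_iff]
  intro f hf
  rw [Submodule.mem_orthogonal] at hf
  rw [Lp.eq_zero_iff_ae_eq_zero]
  refine ae_eq_zero_of_forall_integral_exp_mul ((Lp.memLp f).integrable one_le_two) fun t => ?_
  have := hf (expLp μ (-t)) (Submodule.subset_span ⟨_, rfl⟩)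
  rwa [inner_expLp, neg_neg] at this

/-- The indicator of `(a, b]` as an element of `L²(μ)`. -/
def iocLp (μ : Measure ℝ) [IsFiniteMeasure μ] (a b : ℝ) : Lp ℂ 2 μ :=
  indicatorConstLp 2 (measurableSet_Ioc (a := a) (b := b)) (measure_ne_top μ _) 1

/-- The indicator of `(-∞, a]` as an element of `L²(μ)`. -/
def iicLp (μ : Measure ℝ) [IsFiniteMeasure μ] (a : ℝ) : Lp ℂ 2 μ :=
  indicatorConstLp 2 (measurableSet_Iic (a := a)) (measure_ne_top μ _) 1

theorem iicLp_sub_iicLp {a b : ℝ} (hab : a ≤ b) : iicLp μ b - iicLp μ a = iocLp μ a b := by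
  rw [sub_eq_iff_eq_add, iicLp, iicLp, iocLp, add_comm,
    ← indicatorConstLp_disjoint_union measurableSet_Iic measurableSet_Ioc]
  · simp only [Set.Iic_union_Ioc_eq_Iic hab]
  · exact Set.Iic_disjoint_Ioc le_rfl

theorem span_iocLp_topologicalClosure :
    (Submodule.span ℂ {f | ∃ a b : ℝ, a ≤ b ∧ f = iocLp μ a b}).topologicalClosure = ⊤ := by
  rw [Submodule.topologicalClosure_eq_top_iff, Submodule.eq_bot_iff]
  intro f hf
  rw [Submodule.mem_orthogonal] at hf
  rw [Lp.eq_zero_iff_ae_eq_zero]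
  refine ae_eq_zero_of_forall_setIntegral_Ioc ((Lp.memLp f).integrable one_le_two)
    fun a b hab => ?_
  have := hf (iocLp μ a b) (Submodule.subset_span ⟨a, b, hab, rfl⟩)
  rwa [iocLp, L2.inner_indicatorConstLp_one] at this

/-- A step function as an element of `L²(μ)`. -/
def StepData.toLp (s : StepData) (μ : Measure ℝ) [IsFiniteMeasure μ] : Lp ℂ 2 μ :=
  ∑ i, s.coeff i • iocLp μ (s.left i) (s.right i)

theorem StepData.coeFn_toLp (s : StepData) : ⇑(s.toLp μ) =ᵐ[μ] s.toFun := by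
  have h : ∀ i, ⇑(s.coeff i • iocLp μ (s.left i) (s.right i)) =ᵐ[μ]
      (Set.Ioc (s.left i) (s.right i)).indicator fun _ => s.coeff i := fun i => by
    filter_upwards [Lp.coeFn_smul (s.coeff i) (iocLp μ (s.left i) (s.right i)),
      indicatorConstLp_coeFn (p := 2) (hs := measurableSet_Ioc (a := s.left i) (b := s.right i))
        (hμs := measure_ne_top μ _) (c := (1 : ℂ))] with w h1 h2
    rw [h1, Pi.smul_apply, iocLp, h2]
    by_cases hw : w ∈ Set.Ioc (s.left i) (s.right i) <;> simp [hw]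
  filter_upwards [Lp.coeFn_finsetSum Finset.univ
    (fun i => s.coeff i • iocLp μ (s.left i) (s.right i)), ae_all_iff.2 h] with w h1 h2
  rw [StepData.toLp, h1, Finset.sum_apply, StepData.toFun]
  exact Finset.sum_congr rfl fun i _ => h2 i

theorem exists_stepData_tendsto {φ : ℝ → ℂ} (hφ : MemLp φ 2 μ) :
    ∃ s : ℕ → StepData, Tendsto (fun n => eLpNorm ((s n).toFun - φ) 2 μ) atTop (𝓝 0) := by
  have hmem : hφ.toLp ∈ (Submodule.span ℂ {f | ∃ a b : ℝ, a ≤ b ∧ f = iocLp μ a b}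
      ).topologicalClosure := by
    rw [span_iocLp_topologicalClosure]; trivial
  obtain ⟨v, hv, hlim⟩ := mem_closure_iff_seq_limit.1 hmem
  have hs : ∀ n, ∃ s : StepData, s.toLp μ = v n := fun n => by
    obtain ⟨m, c, g, hg⟩ := Submodule.mem_span_set'.1 (hv n)
    choose a b hab hgab using fun i => (g i).2
    refine ⟨⟨m, c, a, b, hab⟩, ?_⟩
    rw [← hg, StepData.toLp]
    exact Finset.sum_congr rfl fun i _ => by rw [← hgab i]
  choose s hs using hs
  refine ⟨s, ((Lp.tendsto_Lp_iff_tendsto_eLpNorm v φ hφ).1 hlim).congr fun n => ?_⟩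
  rw [← hs n]
  exact eLpNorm_congr_ae ((s n).coeFn_toLp.sub (ae_eq_refl _))

end Density

/-! ### The isometry and the orthogonal process it induces. -/

/-- Two families with the same Gram matrix are related by an isometry, if the first is total. -/
theorem exists_linearIsometry_of_inner_eq {ι E F : Type*} [NormedAddCommGroup E]
    [InnerProductSpace ℂ E] [NormedAddCommGroup F] [InnerProductSpace ℂ F] [CompleteSpace F]
    {e : ι → E} {X : ι → F} (h : ∀ i j, inner ℂ (e i) (e j) = inner ℂ (X i) (X j))
    (hd : (Submodule.span ℂ (Set.range e)).topologicalClosure = ⊤) :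
    ∃ T : E →ₗᵢ[ℂ] F, ∀ i, T (e i) = X i := by
  let A := Finsupp.linearCombination ℂ e
  let B := Finsupp.linearCombination ℂ X
  -- Equal norms on formal combinations make `A c ↦ B c` well defined and isometric, so it extends
  -- from the dense range of `A`.
  have hn : ∀ c, ‖B c‖ = ‖A c‖ := fun c => by
    have : inner ℂ (B c) (B c) = inner ℂ (A c) (A c) := by
      simp only [A, B, Finsupp.linearCombination_apply, Finsupp.sum_inner, Finsupp.inner_sum,
        inner_smul_left, inner_smul_right, h]
    rw [inner_self_eq_norm_sq_to_K, inner_self_eq_norm_sq_to_K] at this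
    have h' : ‖B c‖ ^ 2 = ‖A c‖ ^ 2 := by exact_mod_cast this
    exact (sq_eq_sq₀ (norm_nonneg _) (norm_nonneg _)).1 h'
  have hA : DenseRange A := by
    rw [DenseRange, ← LinearMap.coe_range, Finsupp.range_linearCombination, dense_iff_closure_eq,
      ← Submodule.topologicalClosure_coe, hd]
    rfl
  have hb : ∃ C, ∀ c, ‖B c‖ ≤ C * ‖A c‖ := ⟨1, fun c => by rw [hn, one_mul]⟩
  have hT : ∀ c, B.extendOfNorm A (A c) = B c := LinearMap.extendOfNorm_eq hA hb
  refine ⟨⟨(B.extendOfNorm A).toLinearMap, fun v => ?_⟩, fun i => ?_⟩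
  · refine hA.induction (P := fun v => ‖B.extendOfNorm A v‖ = ‖v‖) ?_
      (isClosed_eq (by fun_prop) (by fun_prop)) v
    rintro _ ⟨c, rfl⟩
    rw [hT, hn]
  · have := hT (Finsupp.single i 1)
    simpa [A, B] using this

variable {Ω : Type*} [MeasurableSpace Ω]

section SpectralProcess

variable {P : Measure Ω} {μ : Measure ℝ} [IsFiniteMeasure μ]

/-- The process with increments `T 1_{(a, b]}` for an isometry `T : L²(μ) → L²(P)`. -/
def spectralProcess (T : Lp ℂ 2 μ →ₗᵢ[ℂ] Lp ℂ 2 P) (w : ℝ) : Ω → ℂ := T (iicLp μ w)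

theorem spectralProcess_sub (T : Lp ℂ 2 μ →ₗᵢ[ℂ] Lp ℂ 2 P) {a b : ℝ} (hab : a ≤ b) :
    ⇑(T (iocLp μ a b)) =ᵐ[P] fun o => spectralProcess T b o - spectralProcess T a o := by
  rw [← iicLp_sub_iicLp hab, map_sub]
  exact Lp.coeFn_sub _ _

/-- `T` preserves the inner product of two indicators. This yields both the variance and the
orthogonality of increments. -/
theorem integral_conj_mul_spectralProcess (T : Lp ℂ 2 μ →ₗᵢ[ℂ] Lp ℂ 2 P) {a b c d : ℝ}
    (hab : a ≤ b) (hcd : c ≤ d) :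
    ∫ o, starRingEnd ℂ (spectralProcess T b o - spectralProcess T a o) *
      (spectralProcess T d o - spectralProcess T c o) ∂P =
      μ.real (Set.Ioc a b ∩ Set.Ioc c d) := by
  have h : inner ℂ (T (iocLp μ a b)) (T (iocLp μ c d)) =
      (μ.real (Set.Ioc a b ∩ Set.Ioc c d) : ℂ) := by
    rw [T.inner_map_map, iocLp, iocLp]
    exact L2.inner_indicatorConstLp_one_indicatorConstLp_one measurableSet_Ioc measurableSet_Ioc
  rw [← h, L2.inner_def]
  refine integral_congr_ae ?_
  filter_upwards [spectralProcess_sub T hab, spectralProcess_sub T hcd] with o h1 h2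
  rw [h1, h2, RCLike.inner_apply, mul_comm]

theorem stepData_integral_spectralProcess (T : Lp ℂ 2 μ →ₗᵢ[ℂ] Lp ℂ 2 P) (s : StepData) :
    ⇑(T (s.toLp μ)) =ᵐ[P] s.integral (spectralProcess T) := by
  have h : ∀ i, ⇑(s.coeff i • T (iocLp μ (s.left i) (s.right i))) =ᵐ[P] fun o =>
      s.coeff i * (spectralProcess T (s.right i) o - spectralProcess T (s.left i) o) := fun i => by
    filter_upwards [Lp.coeFn_smul (s.coeff i) (T (iocLp μ (s.left i) (s.right i))),
      spectralProcess_sub T (s.left_le_right i)] with o h1 h2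
    rw [h1, Pi.smul_apply, h2, smul_eq_mul]
  have hsum : T (s.toLp μ) = ∑ i, s.coeff i • T (iocLp μ (s.left i) (s.right i)) := by
    simp [StepData.toLp, map_sum]
  filter_upwards [Lp.coeFn_finsetSum Finset.univ
    (fun i => s.coeff i • T (iocLp μ (s.left i) (s.right i))), ae_all_iff.2 h] with o h1 h2
  rw [hsum, h1, Finset.sum_apply, StepData.integral]
  exact Finset.sum_congr rfl fun i _ => h2 i

/-- The Itô-type isometry: approximation errors on the frequency and probability sides coincide, so
convergence of step functions transfers to their integrals. -/
theorem eLpNorm_stepData_integral_sub (T : Lp ℂ 2 μ →ₗᵢ[ℂ] Lp ℂ 2 P) {φ : ℝ → ℂ}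
    (hφ : MemLp φ 2 μ) {Y : Ω → ℂ} (hY : ⇑(T hφ.toLp) =ᵐ[P] Y) (s : StepData) :
    eLpNorm (s.integral (spectralProcess T) - Y) 2 P = eLpNorm (s.toFun - φ) 2 μ := by
  calc eLpNorm (s.integral (spectralProcess T) - Y) 2 P
      = eLpNorm (⇑(T (s.toLp μ)) - ⇑(T hφ.toLp)) 2 P :=
        (eLpNorm_congr_ae ((stepData_integral_spectralProcess T s).sub hY)).symm
    _ = edist (s.toLp μ) hφ.toLp := by rw [← Lp.edist_def, T.isometry.edist_eq]
    _ = eLpNorm (s.toFun - φ) 2 μ := by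
        rw [Lp.edist_def]
        exact eLpNorm_congr_ae (s.coeFn_toLp.sub hφ.coeFn_toLp)

end SpectralProcess

theorem isMeanSquareIntegral_spectralProcess {P : Measure Ω} {H : StieltjesFunction ℝ}
    [IsFiniteMeasure H.measure] (T : Lp ℂ 2 H.measure →ₗᵢ[ℂ] Lp ℂ 2 P) {φ : ℝ → ℂ}
    (hφ : MemLp φ 2 H.measure) {Y : Ω → ℂ} (hY : ⇑(T hφ.toLp) =ᵐ[P] Y) :
    IsMeanSquareIntegral (spectralProcess T) H P φ Y where
  memLp_integrand := hφ
  memLp_integral := (memLp_congr_ae hY).1 (Lp.memLp _)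
  exists_approx := exists_stepData_tendsto hφ
  tendsto_integral s hs := by simpa only [eLpNorm_stepData_integral_sub T hφ hY] using hs

theorem isOrthogonalProcess_spectralProcess {P : Measure Ω} {H : StieltjesFunction ℝ}
    [IsFiniteMeasure H.measure] (T : Lp ℂ 2 H.measure →ₗᵢ[ℂ] Lp ℂ 2 P)
    (hT : ∀ f, ∫ o, T f o ∂P = 0) : IsOrthogonalProcess (spectralProcess T) H P where
  memLp w := Lp.memLp _
  mean_incr a b hab := by
    rw [← hT (iocLp H.measure a b)]
    exact integral_congr_ae (spectralProcess_sub T hab).symm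
  variance_incr a b hab := by
    have h := integral_conj_mul_spectralProcess T hab hab
    rw [Set.inter_self, measureReal_def, H.measure_Ioc,
      ENNReal.toReal_ofReal (sub_nonneg.2 (H.mono hab))] at h
    simp only [Complex.conj_mul', ← Complex.ofReal_pow] at h
    rw [integral_complex_ofReal] at h
    exact_mod_cast h
  orthogonal_incr a b c d hab hbc hcd := by
    rw [integral_conj_mul_spectralProcess T hab hcd,
      (Set.disjoint_left.2 fun w hw hw' => (hw.2.trans hbc).not_gt hw'.1).inter_eq]
    simp

/-! ### Spectrum and Cramér representation of `x`. -/

section Stationary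

variable {P : Measure Ω} {x : ℝ → Ω → ℝ}

theorem IsSecondOrderStationary.covFun_eq (hstat : IsSecondOrderStationary x P) (s t : ℝ) :
    covFun x P s t = autocov x P (s - t) := by
  have h := hstat.moment_shift (s - t) 0 t
  rw [sub_add_cancel, zero_add] at h
  exact h

/-- The random variable `x(t)` as an element of the complex Hilbert space `L²(P)`. -/
def IsSecondOrderStationary.toLp (hstat : IsSecondOrderStationary x P) (t : ℝ) : Lp ℂ 2 P :=
  ((hstat.memLp t).ofReal (K := ℂ)).toLp

theorem IsSecondOrderStationary.coeFn_toLp (hstat : IsSecondOrderStationary x P) (t : ℝ) :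
    ⇑(hstat.toLp t) =ᵐ[P] fun o => (x t o : ℂ) :=
  ((hstat.memLp t).ofReal (K := ℂ)).coeFn_toLp

theorem IsSecondOrderStationary.inner_toLp (hstat : IsSecondOrderStationary x P) (s t : ℝ) :
    inner ℂ (hstat.toLp s) (hstat.toLp t) = (autocov x P (t - s) : ℂ) := by
  rw [← hstat.covFun_eq, covFun, ← integral_complex_ofReal, L2.inner_def]
  refine integral_congr_ae ?_
  filter_upwards [hstat.coeFn_toLp s, hstat.coeFn_toLp t] with o h1 h2
  rw [h1, h2, RCLike.inner_apply, Complex.conj_ofReal]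
  push_cast
  ring

theorem IsSecondOrderStationary.continuous_toLp (hstat : IsSecondOrderStationary x P)
    (hcont : IsMeanSquareContinuous x P) : Continuous hstat.toLp := by
  refine continuous_iff_continuousAt.2 fun t => ?_
  refine (Lp.tendsto_Lp_iff_tendsto_eLpNorm'' _ (fun s => (hstat.memLp s).ofReal) _
    (hstat.memLp t).ofReal).2 ((hcont t).congr fun s => ?_)
  refine eLpNorm_congr_norm_ae (Eventually.of_forall fun o => ?_)
  simp only [Pi.sub_apply]
  rw [← Complex.norm_real (x s o - x t o), Complex.ofReal_sub]
  rfl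

theorem IsSecondOrderStationary.continuous_autocov (hstat : IsSecondOrderStationary x P)
    (hcont : IsMeanSquareContinuous x P) : Continuous (autocov x P) := by
  have h := Complex.continuous_re.comp
    (continuous_of_inner_eq_sub (hstat.continuous_toLp hcont) hstat.inner_toLp
      (r := fun τ => (autocov x P τ : ℂ)))
  exact h

theorem IsSecondOrderStationary.norm_sq_toLp (hstat : IsSecondOrderStationary x P) (t : ℝ) :
    ‖hstat.toLp t‖ ^ 2 = autocov x P 0 := by
  exact_mod_cast norm_sq_of_inner_eq_sub hstat.inner_toLp
    (r := fun τ => (autocov x P τ : ℂ)) t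

/-- If `R(u) = R(0)`, then `‖x(0) - x(u)‖² = 2R(0) - 2R(u) = 0`. So `x(0)` and `x(u)` coincide in
`L²` and have the same covariance with `x(-s)`. -/
theorem IsSecondOrderStationary.autocov_add_of_eq (hstat : IsSecondOrderStationary x P) {u : ℝ}
    (hu : autocov x P u = autocov x P 0) (s : ℝ) : autocov x P (s + u) = autocov x P s := by
  have h : ‖hstat.toLp 0 - hstat.toLp u‖ ^ 2 = 0 := by
    rw [norm_sub_sq (𝕜 := ℂ), hstat.norm_sq_toLp, hstat.norm_sq_toLp, hstat.inner_toLp, sub_zero,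
      hu]
    simp
    ring
  have h' : hstat.toLp 0 = hstat.toLp u := by
    rwa [sq_eq_zero_iff, norm_eq_zero, sub_eq_zero] at h
  have h1 := hstat.inner_toLp (-s) 0
  rw [h', hstat.inner_toLp] at h1
  have h2 : autocov x P (u - -s) = autocov x P (0 - -s) := by exact_mod_cast h1
  rwa [sub_neg_eq_add, sub_neg_eq_add, zero_add, add_comm] at h2

theorem IsIntegratedSpectrum.isFiniteMeasure {H : StieltjesFunction ℝ}
    (hH : IsIntegratedSpectrum x P H) : IsFiniteMeasure H.measure :=
  H.isFiniteMeasure hH.tendsto_atBot hH.tendsto_atTop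

theorem charFun_eq_integral_exp_I_mul (μ : Measure ℝ) (τ : ℝ) :
    charFun μ τ = ∫ w : ℝ, Complex.exp (Complex.I * w * τ) ∂μ := by
  rw [charFun_apply_real]
  congr 1 with w
  congr 1
  ring

theorem IsIntegratedSpectrum.unique {H₁ H₂ : StieltjesFunction ℝ}
    (h₁ : IsIntegratedSpectrum x P H₁) (h₂ : IsIntegratedSpectrum x P H₂) : H₁ = H₂ := by
  have := h₁.isFiniteMeasure
  have := h₂.isFiniteMeasure
  refine H₁.eq_of_measure_of_tendsto_atBot H₂ ?_ h₁.tendsto_atBot h₂.tendsto_atBot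
  refine Measure.ext_of_charFun (funext fun τ => ?_)
  rw [charFun_eq_integral_exp_I_mul, charFun_eq_integral_exp_I_mul, ← h₁.autocov_eq,
    ← h₂.autocov_eq]

/-- The Wiener–Khintchine theorem: a mean-square continuous stationary process has an integrated
spectrum. -/
theorem IsSecondOrderStationary.exists_isIntegratedSpectrum
    (hstat : IsSecondOrderStationary x P) (hcont : IsMeanSquareContinuous x P) :
    ∃ H : StieltjesFunction ℝ, IsIntegratedSpectrum x P H := by
  have h0 : 0 ≤ autocov x P 0 := by rw [← hstat.norm_sq_toLp 0]; positivity
  -- Bochner's theorem is applied to `R / R(0)`. When `R(0) = 0`, all of `R` vanishes and so does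
  -- the spectrum.
  rcases h0.eq_or_lt with h0 | h0
  · have hz : ∀ τ, autocov x P τ = 0 := fun τ => by
      have h := norm_le_of_inner_eq_sub hstat.inner_toLp (r := fun τ => (autocov x P τ : ℂ)) τ
      rw [hstat.norm_sq_toLp, ← h0] at h
      exact_mod_cast norm_le_zero_iff.1 h
    refine ⟨0, ?_, ?_, fun τ => ?_⟩
    · exact tendsto_const_nhds
    · rw [← h0]; exact tendsto_const_nhds
    · rw [hz, StieltjesFunction.measure_zero]; simp
  · set c := autocov x P 0 with hc
    let X : ℝ → Lp ℂ 2 P := fun t => (((√c)⁻¹ : ℝ) : ℂ) • hstat.toLp t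
    have hX : Continuous X := by
      have := hstat.continuous_toLp hcont
      fun_prop
    have hinner : ∀ s t, inner ℂ (X s) (X t) = ((autocov x P (t - s) / c : ℝ) : ℂ) := fun s t => by
      simp only [X]
      rw [inner_smul_left, inner_smul_right, hstat.inner_toLp, Complex.conj_ofReal]
      norm_cast
      rw [← mul_assoc, ← mul_inv, Real.mul_self_sqrt h0.le]
      ring
    obtain ⟨ν, hν, hchar⟩ := exists_charFun_eq_of_inner_eq_sub hX
      (r := fun τ => ((autocov x P τ / c : ℝ) : ℂ)) hinner (by simp [← hc, h0.ne'])
    let H : StieltjesFunction ℝ := c.toNNReal • ProbabilityTheory.cdf ν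
    have hHv : ∀ w, H w = c * ProbabilityTheory.cdf ν w := fun w => by
      change (c.toNNReal : ℝ) * _ = _
      rw [Real.coe_toNNReal c h0.le]
    have hHf : ⇑H = fun w => c * ProbabilityTheory.cdf ν w := funext hHv
    refine ⟨H, ?_, ?_, fun τ => ?_⟩
    · rw [hHf]
      simpa using (ProbabilityTheory.tendsto_cdf_atBot ν).const_mul c
    · rw [hHf]
      simpa using (ProbabilityTheory.tendsto_cdf_atTop ν).const_mul c
    · rw [StieltjesFunction.measure_smul, ProbabilityTheory.measure_cdf,
        integral_smul_nnreal_measure, ← charFun_eq_integral_exp_I_mul, hchar, NNReal.smul_def,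
        Real.coe_toNNReal c h0.le, Complex.real_smul, ← Complex.ofReal_mul,
        mul_div_cancel₀ _ h0.ne']

/-- The Cramér representation of a mean-square continuous stationary process. -/
theorem IsIntegratedSpectrum.exists_isCramerProcess [IsProbabilityMeasure P]
    (hstat : IsSecondOrderStationary x P)
    (hmean : ∀ t, ∫ o, x t o ∂P = 0) {H : StieltjesFunction ℝ}
    (hH : IsIntegratedSpectrum x P H) : ∃ Z : ℝ → Ω → ℂ, IsCramerProcess x Z H P := by
  have := hH.isFiniteMeasure
  obtain ⟨T, hT⟩ := exists_linearIsometry_of_inner_eq (e := expLp H.measure) (X := hstat.toLp)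
    (fun s t => by rw [inner_expLp_expLp, hstat.inner_toLp, hH.autocov_eq])
    span_expLp_topologicalClosure
  let one : Lp ℂ 2 P := Lp.const 2 P 1
  have hone : ∀ f : Lp ℂ 2 P, inner ℂ one f = ∫ o, f o ∂P := fun f => by
    rw [L2.inner_def]
    refine integral_congr_ae ?_
    filter_upwards [Lp.coeFn_const (p := 2) (μ := P) (c := (1 : ℂ))] with o ho
    rw [ho]
    simp
  -- The mean of `T f` is its inner product with `1`, hence continuous in `f`. It vanishes on the
  -- total family of exponentials because `x` has mean zero.
  have hzero : (innerSL ℂ one).comp T.toContinuousLinearMap = 0 := by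
    refine ContinuousLinearMap.ext_on (s := Set.range (expLp H.measure)) ?_ ?_
    · rw [dense_iff_closure_eq, ← Submodule.topologicalClosure_coe, span_expLp_topologicalClosure]
      rfl
    · rintro _ ⟨t, rfl⟩
      simp only [ContinuousLinearMap.comp_apply, LinearIsometry.coe_toContinuousLinearMap,
        innerSL_apply_apply, hT, hone, _root_.zero_apply]
      rw [integral_congr_ae (hstat.coeFn_toLp t), integral_complex_ofReal, hmean,
        Complex.ofReal_zero]
  refine ⟨spectralProcess T, isOrthogonalProcess_spectralProcess T fun f => ?_, fun t => ?_⟩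
  · rw [← hone]
    exact DFunLike.congr_fun hzero f
  · refine isMeanSquareIntegral_spectralProcess T (memLp_exp_I_mul H.measure t) ?_
    change ⇑(T (expLp H.measure t)) =ᵐ[P] _
    rw [hT]
    exact hstat.coeFn_toLp t

end Stationary

/-! ### Time changes and the resampled process. -/

theorem IsInverseTimeChange.add_eq {k g : ℝ → ℝ} (hg : IsInverseTimeChange k g) (r : ℝ) :
    (r + g r) + k (r + g r) = r :=
  ((hg _ r).2 rfl).symm

/-- The inverse homeomorphism is `r ↦ r + g r`, and it is smooth by the inverse function theorem. -/
theorem IsInverseTimeChange.contDiff {k g : ℝ → ℝ} (hg : IsInverseTimeChange k g)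
    (hbij : Function.Bijective fun t => t + k t) (hk : ContDiff ℝ ∞ k)
    (hk' : ∀ t, 1 + deriv k t ≠ 0) : ContDiff ℝ ∞ g := by
  obtain ⟨h, hh, -⟩ := exists_homeomorph_of_continuous_bijective
    (continuous_id.add hk.continuous) hbij
  have hsymm : ∀ r, h.symm r = r + g r := fun r => by
    rw [h.symm_apply_eq, hh]
    exact (hg.add_eq r).symm
  have hd : ContDiff ℝ ∞ h.symm := by
    refine h.contDiff_symm_deriv (f' := fun t => 1 + deriv k t) hk' (fun t => ?_) ?_
    · rw [hh]
      exact (hasDerivAt_id t).add (hk.differentiable (by simp) t).hasDerivAt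
    · rw [hh]
      exact contDiff_id.add hk
  have hgeq : g = fun r => h.symm r - r := by
    ext r
    rw [hsymm]
    ring
  rw [hgeq]
  exact hd.sub contDiff_id

/-- The resampled process is stationary exactly for affine time changes, unless the
autocovariance function of the original process is constant. -/
theorem IsSecondOrderStationary.isSecondOrderStationary_resampled_iff {P : Measure Ω}
    {x y : ℝ → Ω → ℝ} (hstat : IsSecondOrderStationary x P) (hcont : IsMeanSquareContinuous x P)
    {k g : ℝ → ℝ} (hk : Continuous k) (hbij : Function.Bijective fun t => t + k t)
    (hg : IsInverseTimeChange k g) (hy : ∀ r, y r = x (r + g r))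
    (hne : ∃ τ, autocov x P τ ≠ autocov x P 0) :
    IsSecondOrderStationary y P ↔ ∃ a b : ℝ, ∀ r, g r = a * r + b := by
  constructor
  · intro hys
    obtain ⟨h, hh, hmono⟩ := exists_homeomorph_of_continuous_bijective
      (continuous_id.add hk) hbij
    have hsymm : ∀ r, h.symm r = r + g r := fun r => by
      rw [h.symm_apply_eq, hh]
      exact (hg.add_eq r).symm
    have hcov : ∀ r s, covFun y P r s = autocov x P (h.symm r - h.symm s) := fun r s => by
      rw [← hstat.covFun_eq, covFun, covFun, hy, hy, hsymm, hsymm]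
    obtain ⟨a, b, hab⟩ := affine_of_shift_invariant (hstat.continuous_autocov hcont)
      (fun u hu => hstat.autocov_add_of_eq hu) hne h.symm
      (by rw [h.symm_symm, hh]; exact hmono) fun r s τ => by
        rw [← hcov, ← hcov]
        exact hys.moment_shift r s τ
    refine ⟨a - 1, b, fun r => ?_⟩
    have := hab r
    rw [hsymm] at this
    linarith
  · rintro ⟨a, b, hab⟩
    have hy' : ∀ r τ, y (r + τ) = x (r + g r + (a + 1) * τ) := fun r τ => by
      rw [hy, hab, hab]
      congr 1
      ring
    refine ⟨fun r => ?_, fun r τ => ?_, fun r s τ => ?_⟩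
    · rw [hy]; exact hstat.memLp _
    · rw [hy', hy r]; exact hstat.mean_shift _ _
    · rw [hy', hy', hy r, hy s]; exact hstat.moment_shift _ _ _

theorem conj_resampledBasis_mul (g : ℝ → ℝ) (r' r w : ℝ) :
    starRingEnd ℂ (resampledBasis g r' w) * resampledBasis g r w =
      Complex.exp (Complex.I * w * ((r + g r) - (r' + g r') : ℝ)) := by
  rw [resampledBasis, resampledBasis, ← Complex.exp_conj, ← Complex.exp_add]
  congr 1
  simp only [map_mul, Complex.conj_I, Complex.conj_ofReal]
  push_cast
  ring

end

/-! ### Assembly of the main theorem. -/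

theorem mainTheorem1 {Ω : Type*} [MeasurableSpace Ω] (P : Measure Ω) [IsProbabilityMeasure P]
    (x : ℝ → Ω → ℝ) (hstat : IsSecondOrderStationary x P) (hmean : ∀ t, ∫ o, x t o ∂P = 0)
    (hcont : IsMeanSquareContinuous x P) :
    (∃! H : StieltjesFunction ℝ, IsIntegratedSpectrum x P H) ∧
    ∀ H : StieltjesFunction ℝ, IsIntegratedSpectrum x P H →
      (∃ Z : ℝ → Ω → ℂ, IsCramerProcess x Z H P) ∧
      ∀ k : ℝ → ℝ, Continuous k → Function.Bijective (fun t => t + k t) →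
        (∃! g : ℝ → ℝ, IsInverseTimeChange k g) ∧
        (∃! y : ℝ → Ω → ℝ, IsResampled x k y) ∧
        ∀ (g : ℝ → ℝ) (y : ℝ → Ω → ℝ), IsInverseTimeChange k g → IsResampled x k y →
          -- the inverse time change is smooth when the time change is smooth and regular
          (ContDiff ℝ ∞ k → (∀ t, 1 + deriv k t ≠ 0) → ContDiff ℝ ∞ g) ∧
          -- `y` is a zero-mean second-order process
          (∀ r, MemLp (y r) 2 P ∧ ∫ o, y r o ∂P = 0) ∧
          -- it is non-stationary for every non-affine time change, unless `R` is constant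
          ((∃ τ, autocov x P τ ≠ autocov x P 0) →
            (IsSecondOrderStationary y P ↔ ∃ a b : ℝ, ∀ r, g r = a * r + b)) ∧
          -- generalized Wiener-Khintchine relation
          (∀ r, MemLp (resampledBasis g r) 2 H.measure) ∧
          (∀ r' r, (covFun y P r' r : ℂ) =
            ∫ w, starRingEnd ℂ (resampledBasis g r' w) * resampledBasis g r w ∂H.measure) ∧
          -- generalized Cramér representation, with the orthogonal process of `x`
          (∀ Z : ℝ → Ω → ℂ, IsCramerProcess x Z H P →
            ∀ r, IsMeanSquareIntegral Z H P (resampledBasis g r) (fun o => (y r o : ℂ))) := by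
  refine ⟨?_, fun H hH => ⟨hH.exists_isCramerProcess hstat hmean, fun k hk hbij => ?_⟩⟩
  · obtain ⟨H, hH⟩ := hstat.exists_isIntegratedSpectrum hcont
    exact ⟨H, hH, fun H' hH' => hH'.unique hH⟩
  have hfin := hH.isFiniteMeasure
  obtain ⟨θ, hθl, hθr⟩ := Function.bijective_iff_has_inverse.1 hbij
  refine ⟨⟨fun r => θ r - r, fun t r => ?_, fun g hg => ?_⟩,
    ⟨fun r => x (θ r), fun t r h => ?_, fun y hy => ?_⟩, fun g y hg hy => ?_⟩
  · rw [add_sub_cancel]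
    constructor
    · rintro rfl
      exact (hθl t).symm
    · rintro rfl
      exact (hθr r).symm
  · ext r
    have h := (hg (θ r) r).1 (hθr r).symm
    linarith
  · rw [h]
    exact congrArg x (hθl t)
  · ext1 r
    exact hy (θ r) r (hθr r).symm
  have hyx : ∀ r, y r = x (r + g r) := fun r => hy _ r (hg.add_eq r).symm
  refine ⟨hg.contDiff hbij, fun r => ?_,
    hstat.isSecondOrderStationary_resampled_iff hcont hk hbij hg hyx,
    fun r => memLp_exp_I_mul H.measure (r + g r), fun r' r => ?_, fun Z hZ r => ?_⟩
  · rw [hyx]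
    exact ⟨hstat.memLp _, hmean _⟩
  · have hcov : covFun y P r' r = autocov x P ((r + g r) - (r' + g r')) := by
      rw [← hstat.covFun_eq, covFun, covFun, hyx, hyx]
      simp only [mul_comm]
    rw [hcov, hH.autocov_eq]
    simp only [conj_resampledBasis_mul]
  -- `resampledBasis g r` is the exponential at time `r + g r`, so the representation of `x` at that
  -- time applies verbatim, whatever the choice of `Z`.
  · rw [hyx]
    exact hZ.repr (r + g r)
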